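/- Let $d\in\mathbb N$ and let $\rho,\sigma$ be density operators on $\mathbb C^d$ (positive semidefinite complex $d\times d$ matrices of trace one). Let $\rho_n,\sigma_n$ ($n\in\mathbb N$) be random density operators, i.e. Borel-measurable maps from a probability space to the set of density operators, and let $(r_n)$ be a sequence of positive reals with $r_n\to\infty$. For matrices $A,B$ write $A\ll B$ if the support of $A$ (the orthogonal complement of its kernel) is contained in the support of $B$. Let $D(\rho\|\sigma)=\mathrm{Tr}[\rho(\log\rho-\log\sigma)]$ if $\rho\ll\sigma$ and $D(\rho\|\sigma)=\infty$ otherwise, where the (natural) logarithm of a positive semidefinite matrix is taken on its support and is zero on its kernel. For positive semidefinite $A$, let $\mathcal H(A)$ be the real vector space of Hermitian matrices $B$ with $B\ll A$, and let $D[\log A](H)$ and $D^2[\log A](H_1,H_2)$ be the first and second Fréchet derivatives at $A$ of $B\mapsto\log B$ as a function on $\mathcal H(A)$, in directions $H,H_1,H_2\in\mathcal H(A)$ (so $\mathcal H(A)$ consists of all Hermitian matrices if $A$ is invertible). Assume that $\rho_n\ll\sigma_n\ll\sigma$ and $\rho_n\ll\rho\ll\sigma$ almost surely, for every $n$. Let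 $L_1,L_2$ be random $d\times d$ complex matrices; convergence "$\to$" of random elements below is weak convergence (convergence in distribution). (i) (Alternative.) If $\big(r_n(\rho_n-\rho),\,r_n(\sigma_n-\sigma)\big)\to(L_1,L_2)$ jointly, then $\log$ is Fréchet differentiable at $\sigma$ on $\mathcal H(\sigma)$, almost surely $L_1\in\mathcal H(\rho)$ and $L_2\in\mathcal H(\sigma)$, and $$r_n\big(D(\rho_n\|\sigma_n)-D(\rho\|\sigma)\big)\to \mathrm{Tr}\big[L_1(\log\rho-\log\sigma)-\rho\,D[\log\sigma](L_2)\big].$$ (ii) (Null.) If $\rho=\sigma$ and $\big(r_n(\rho_n-\rho),\,r_n(\sigma_n-\rho)\big)\to(L_1,L_2)$ jointly, then $\log$ is twice Fréchet differentiable at $\rho$ on $\mathcal H(\rho)$, almost surely $L_1,L_2\in\mathcal H(\rho)$, and $$r_n^2\,D(\rho_n\|\sigma_n)\to \mathrm{Tr}\big[L_1\,D[\log\rho](L_1-L_2)\big]+\tfrac12\mathrm{Tr}\big[\rho\,D^2[\log\rho](L_1-L_2,\,L_1+L_2)\big].$$ -/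

import Mathlib

open MeasureTheory Filter Topology
open scoped ComplexOrder Matrix.Norms.L2Operator

/-- Complex d-by-d matrices, i.e. the linear operators on the Hilbert space `ℂ^d`.  (They carry
the operator norm; only the topology matters, and all norms on this space are equivalent.) -/
abbrev Op (d : ℕ) : Type := Matrix (Fin d) (Fin d) ℂ

/-- Operators carry their Borel `σ`-algebra. -/
noncomputable instance Op.instMeasurableSpace (d : ℕ) : MeasurableSpace (Op d) := borel (Op d)

instance Op.instBorelSpace (d : ℕ) : BorelSpace (Op d) := ⟨rfl⟩

/-- Density operators: positive semidefinite with unit trace. -/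
abbrev DensityOp (d : ℕ) : Type := {A : Op d // A.PosSemidef ∧ A.trace = 1}

theorem DensityOp.isHermitian {d : ℕ} (ρ : DensityOp d) : (ρ : Op d).IsHermitian :=
  ρ.2.1.isHermitian

/-- The support of an operator: the orthogonal complement of its kernel. -/
noncomputable def opSupport {d : ℕ} (A : Op d) : Submodule ℂ (EuclideanSpace ℂ (Fin d)) :=
  (LinearMap.ker (Matrix.toEuclideanLin A))ᗮ

/-- `A ≪ B`: the support of `A` is contained in the support of `B`. -/
def SuppLE {d : ℕ} (A B : Op d) : Prop := opSupport A ≤ opSupport B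

theorem suppLE_iff_ker {d : ℕ} (A B : Op d) :
    SuppLE A B ↔ LinearMap.ker (Matrix.toEuclideanLin B) ≤ LinearMap.ker (Matrix.toEuclideanLin A) :=
  Submodule.orthogonal_le_orthogonal_iff

/-- The operator logarithm of a Hermitian operator, by functional calculus.  Since
`Real.log 0 = 0`, the logarithm of a positive semidefinite operator is taken on its support and
extended by zero to its kernel. -/
noncomputable def opLog {d : ℕ} (A : Op d) : Op d := cfc Real.log A

open Classical in
/-- Quantum relative entropy `D(ρ‖σ)`: `Tr[ρ (log ρ - log σ)]` if `ρ ≪ σ` and `∞` otherwise.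
(The trace is real for Hermitian `ρ` and `σ`.) -/
noncomputable def quantumRelEntropy {d : ℕ} (ρ σ : Op d) : EReal :=
  if SuppLE ρ σ then (((ρ * (opLog ρ - opLog σ)).trace.re : ℝ) : EReal) else ⊤

/-- The real vector space of Hermitian operators supported in the support of `A`, i.e. the
Hermitian operators on the Hilbert space `supp A`.  It consists of all Hermitian operators
if `A` is invertible. -/
def hermitianOn {d : ℕ} (A : Op d) : Submodule ℝ (Op d) where
  carrier := {B | B.IsHermitian ∧ SuppLE B A}
  zero_mem' := ⟨Matrix.isHermitian_zero, by
    rw [suppLE_iff_ker]; intro v _; simp⟩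
  add_mem' := by
    rintro B C ⟨hB, hB'⟩ ⟨hC, hC'⟩
    refine ⟨hB.add hC, ?_⟩
    rw [suppLE_iff_ker] at *
    intro v hv
    have h1 := hB' hv
    have h2 := hC' hv
    rw [LinearMap.mem_ker] at *
    rw [map_add, LinearMap.add_apply, h1, h2, add_zero]
  smul_mem' := by
    rintro c B ⟨hB, hB'⟩
    refine ⟨?_, ?_⟩
    · rw [Matrix.IsHermitian, Matrix.conjTranspose_smul, hB.eq, star_trivial]
    rw [suppLE_iff_ker] at *
    intro v hv
    have h1 := hB' hv
    rw [LinearMap.mem_ker] at *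
    have h2 : (c • B : Op d) = (c : ℂ) • B := by
      ext i j; simp
    rw [h2, map_smul, LinearMap.smul_apply, h1, smul_zero]

theorem self_mem_hermitianOn {d : ℕ} {A : Op d} (hA : A.IsHermitian) : A ∈ hermitianOn A :=
  ⟨hA, le_refl _⟩

/-- The logarithm as a function on the Hermitian operators on the support of `A`. -/
noncomputable def logOn {d : ℕ} (A : Op d) : hermitianOn A → Op d := fun B => opLog (B : Op d)

/-- A Hermitian operator `A` as a point of `hermitianOn A`. -/
def basePt {d : ℕ} (A : Op d) (hA : A.IsHermitian) : hermitianOn A := ⟨A, self_mem_hermitianOn hA⟩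

/-- `log` is Fréchet differentiable at `A` (on the support of `A`). -/
def LogDiffAt {d : ℕ} (A : Op d) (hA : A.IsHermitian) : Prop :=
  DifferentiableAt ℝ (logOn A) (basePt A hA)

/-- `log` is twice Fréchet differentiable at `A` (on the support of `A`): it is differentiable
near `A`, and its derivative is differentiable at `A`. -/
def LogTwiceDiffAt {d : ℕ} (A : Op d) (hA : A.IsHermitian) : Prop :=
  (∀ᶠ B in 𝓝 (basePt A hA), DifferentiableAt ℝ (logOn A) B) ∧
    DifferentiableAt ℝ (fderiv ℝ (logOn A)) (basePt A hA)

open Classical in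
/-- `D[log A](H)`: the Fréchet derivative at `A` of `log`, on the space of Hermitian operators
supported in `supp A`, in a direction `H` of that space (and `0` for other matrices `H`). -/
noncomputable def dLog {d : ℕ} (A : Op d) (hA : A.IsHermitian) (H : Op d) : Op d :=
  if h : H ∈ hermitianOn A then fderiv ℝ (logOn A) (basePt A hA) ⟨H, h⟩ else 0

open Classical in
/-- `D²[log A](H₁, H₂)`: the second Fréchet derivative at `A` of `log`, on the space of Hermitian
operators supported in `supp A`, in directions `H₁, H₂` of that space (and `0` otherwise). -/
noncomputable def d2Log {d : ℕ} (A : Op d) (hA : A.IsHermitian) (H₁ H₂ : Op d) : Op d :=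
  if h : H₁ ∈ hermitianOn A ∧ H₂ ∈ hermitianOn A then
    fderiv ℝ (fderiv ℝ (logOn A)) (basePt A hA) ⟨H₁, h.1⟩ ⟨H₂, h.2⟩
  else 0

/-!
The proof is the delta method: near `(ρ, σ)` the relative entropy has a Taylor expansion, of
order one in general and of order two if `ρ = σ`, and the rescaled remainder vanishes in
probability because a sequence that converges in distribution is tight.

*Smoothness.*  On Hermitian `B` supported in `supp A`, adding the projection `kerProj A` onto the
kernel of `A` does not change the logarithm (`opLog_add_of_isIdempotentElem`), since `log 1 = 0`.
The sum `A + kerProj A` is positive definite, so a multiple `c⁻¹ (A + kerProj A)` of it is at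
distance less than one from the identity, and near `A` the logarithm is the composition of an
affine map with the power series `∑ xⁿ / n = -log (1 - x)` in the Banach algebra of matrices
(`logOn_eventuallyEq`).  Hence `logOn A` is smooth at `A` (`contDiffAt_logOn`).

*First order term.*  The derivative of the logarithm has no simple closed form, as directions need
not commute with `A`.  But under a trace against a matrix commuting with `A` the series may be
differentiated as in the commutative case, and summing a geometric series gives
`Tr[A D[log A](H)] = Tr[H]` (`reTrace_mul_fderiv_logOn`).  For differences of density operators
this trace is zero.  So in the first order expansion (`isLittleO_relEntropy_one`) the derivative
of `log ρ` drops out, and for `ρ = σ` the whole first order term drops out, which leaves the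
quadratic form of `isLittleO_relEntropy_two`; the symmetry of the second derivative turns
`D²(h, h) - D²(k, k)` into `D²(h - k, h + k)`.

*Probability.*  `tendstoInDistribution_of_expansion` converts such an expansion on a subspace into
convergence in distribution, using the continuous mapping theorem, tightness and Slutsky's theorem.
The limit stays in the subspace because subspaces of a finite-dimensional space are closed.
Measurability of the relative entropy follows by approximating `Real.log`, which is discontinuous
at `0`, pointwise by continuous functions (`measurable_opLog_comp`).
-/

/-! ### Convergence in distribution -/

/-- Almost sure membership in a closed set passes to limits in distribution. -/
theorem ae_mem_of_tendstoInDistribution {E Ω Ω' : Type*} [TopologicalSpace E]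
    [HasOuterApproxClosed E] [MeasurableSpace E] [OpensMeasurableSpace E]
    [MeasurableSpace Ω] [MeasurableSpace Ω'] {P : Measure Ω} [IsProbabilityMeasure P]
    {P' : Measure Ω'} [IsProbabilityMeasure P'] {Y : ℕ → Ω → E} {Z : Ω' → E}
    (hY : TendstoInDistribution Y atTop Z (fun _ => P) P') {C : Set E} (hC : IsClosed C)
    (h : ∀ n, ∀ᵐ ω ∂P, Y n ω ∈ C) : ∀ᵐ ω' ∂P', Z ω' ∈ C := by
  have h1 := ProbabilityMeasure.limsup_measure_closed_le_of_tendsto hY.tendsto hC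
  have hn : ∀ n, (P.map (Y n)) C = 1 := fun n => by
    have : IsProbabilityMeasure (P.map (Y n)) :=
      Measure.isProbabilityMeasure_map (hY.forall_aemeasurable n)
    rw [← mem_ae_iff_prob_eq_one₀ hC.measurableSet.nullMeasurableSet]
    exact (ae_map_iff (hY.forall_aemeasurable n) hC.measurableSet).2 (h n)
  have : IsProbabilityMeasure (P'.map Z) := Measure.isProbabilityMeasure_map hY.aemeasurable_limit
  simp only [ProbabilityMeasure.coe_mk, hn, limsup_const] at h1
  have h2 : (P'.map Z) C = 1 := le_antisymm prob_le_one h1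
  rw [← mem_ae_iff_prob_eq_one₀ hC.measurableSet.nullMeasurableSet] at h2
  exact (ae_map_iff hY.aemeasurable_limit hC.measurableSet).1 h2

/-- A sequence that converges in distribution is eventually bounded with high probability. -/
theorem exists_eventually_measure_norm_ge_lt {E Ω Ω' : Type*} [NormedAddCommGroup E]
    [CompleteSpace E] [SecondCountableTopology E] [MeasurableSpace E] [BorelSpace E]
    [MeasurableSpace Ω] [MeasurableSpace Ω'] {P : Measure Ω} [IsProbabilityMeasure P]
    {P' : Measure Ω'} [IsProbabilityMeasure P'] {Y : ℕ → Ω → E} {Z : Ω' → E}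
    (hY : TendstoInDistribution Y atTop Z (fun _ => P) P') {ε : ENNReal} (hε : 0 < ε) :
    ∃ M : ℝ, ∀ᶠ n in atTop, P {ω | M ≤ ‖Y n ω‖} < ε := by
  have : IsProbabilityMeasure (P'.map Z) := Measure.isProbabilityMeasure_map hY.aemeasurable_limit
  have ht := tendsto_measure_compl_closedBall_of_isTightMeasureSet
    (isTightMeasureSet_singleton (μ := P'.map Z)) 0
  simp only [Set.mem_singleton_iff, iSup_iSup_eq_left] at ht
  obtain ⟨M, hM⟩ := (ht.eventually_lt_const hε).exists
  refine ⟨M + 1, ?_⟩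
  have hcl : IsClosed {y : E | M + 1 ≤ ‖y‖} := isClosed_le continuous_const continuous_norm
  have h1 := ProbabilityMeasure.limsup_measure_closed_le_of_tendsto hY.tendsto hcl
  have h2 : (P'.map Z) {y : E | M + 1 ≤ ‖y‖} < ε := by
    refine (measure_mono fun y hy => ?_).trans_lt hM
    have hy' : M + 1 ≤ ‖y‖ := hy
    simp only [Set.mem_compl_iff, Metric.mem_closedBall, dist_zero_right, not_le]
    linarith
  filter_upwards [eventually_lt_of_limsup_lt (h1.trans_lt h2)] with n hn
  rwa [ProbabilityMeasure.coe_mk,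
    Measure.map_apply_of_aemeasurable (hY.forall_aemeasurable n) hcl.measurableSet] at hn

/-- The probabilistic half of the delta method: if `Y n` converges in distribution and the real
random variables `Z n` agree with `q (Y n)` up to an error that vanishes uniformly as long as
`Y n` stays bounded, then `Z n` converges in distribution to the image of the limit under `q`. -/
theorem tendstoInDistribution_of_bounded_approx {E Ω Ω' : Type*} [NormedAddCommGroup E]
    [CompleteSpace E] [SecondCountableTopology E] [MeasurableSpace E] [BorelSpace E]
    [MeasurableSpace Ω] [MeasurableSpace Ω'] {P : Measure Ω} [IsProbabilityMeasure P]
    {P' : Measure Ω'} [IsProbabilityMeasure P'] {Y : ℕ → Ω → E} {Y' : Ω' → E}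
    (hY : TendstoInDistribution Y atTop Y' (fun _ => P) P') {q : E → ℝ} (hq : Continuous q)
    {Z : ℕ → Ω → ℝ} (hZ : ∀ n, AEMeasurable (Z n) P)
    (h : ∀ M : ℝ, ∀ η > 0, ∀ᶠ n in atTop, ∀ᵐ ω ∂P, ‖Y n ω‖ < M → |Z n ω - q (Y n ω)| < η) :
    TendstoInDistribution Z atTop (q ∘ Y') (fun _ => P) P' := by
  refine tendstoInDistribution_of_tendstoInMeasure_sub Z (q ∘ Y')
    (hY.continuous_comp hq) ?_ hZ
  rw [tendstoInMeasure_iff_norm]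
  intro η hη
  rw [ENNReal.tendsto_nhds_zero]
  intro ε hε
  obtain ⟨M, hM⟩ := exists_eventually_measure_norm_ge_lt hY hε
  filter_upwards [hM, h M η hη] with n hn1 hn2
  refine le_trans (measure_mono_ae ?_) hn1.le
  filter_upwards [hn2] with ω hω hle
  by_contra hlt
  have hlt' : ‖Y n ω‖ < M := not_le.1 hlt
  have hle' : η ≤ |Z n ω - q (Y n ω)| := by simpa using! hle
  exact absurd (hω hlt') (not_lt.2 hle')

/-- A remainder of order `o(‖y‖ ^ k)`, rescaled at rate `r n → ∞`, tends to zero uniformly on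
bounded sets. -/
theorem eventually_forall_norm_lt_abs_pow_mul_lt {E : Type*} [NormedAddCommGroup E]
    [NormedSpace ℝ E] {R : E → ℝ} {k : ℕ} (hR : R =o[𝓝 0] fun y => ‖y‖ ^ k) {r : ℕ → ℝ}
    (hr_pos : ∀ n, 0 < r n) (hr : Tendsto r atTop atTop) (M : ℝ) {η : ℝ} (hη : 0 < η) :
    ∀ᶠ n in atTop, ∀ y : E, ‖y‖ < M → |r n ^ k * R ((r n)⁻¹ • y)| < η := by
  rcases le_or_gt M 0 with hM | hM
  · exact Eventually.of_forall fun n y hy => absurd (hy.trans_le hM) (not_lt.2 (norm_nonneg _))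
  have hc : 0 < η / (2 * M ^ k) := by positivity
  obtain ⟨δ, hδ, hb⟩ := Metric.eventually_nhds_iff.1 (hR.def hc)
  filter_upwards [hr.eventually_gt_atTop (M / δ)] with n hn y hy
  have hrn := hr_pos n
  have h1 : ‖(r n)⁻¹ • y‖ < δ := by
    rw [norm_smul, norm_inv, Real.norm_of_nonneg hrn.le, inv_mul_lt_iff₀ hrn]
    rw [div_lt_iff₀ hδ] at hn
    exact hy.trans hn
  have h2 := hb (y := (r n)⁻¹ • y) (by simpa using h1)
  rw [Real.norm_eq_abs, norm_pow, norm_norm, norm_smul, norm_inv, Real.norm_of_nonneg hrn.le] at h2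
  rw [abs_mul, abs_of_pos (pow_pos hrn k)]
  calc r n ^ k * |R ((r n)⁻¹ • y)| ≤ r n ^ k * (η / (2 * M ^ k) * ((r n)⁻¹ * ‖y‖) ^ k) := by gcongr
    _ = η / (2 * M ^ k) * ‖y‖ ^ k := by rw [mul_pow, inv_pow]; field_simp
    _ ≤ η / (2 * M ^ k) * M ^ k := by gcongr
    _ = η / 2 := by field_simp
    _ < η := half_lt_self hη

/-! ### Measurability of the operator logarithm -/

/-- A continuous approximation of `Real.log`; the factor in front forces the value `0` at `0`. -/
noncomputable def logApprox (k : ℕ) (x : ℝ) : ℝ :=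
  k * |x| / (1 + k * |x|) * (Real.log (x ^ 2 + 1 / ((k : ℝ) + 1)) / 2)

theorem continuous_logApprox (k : ℕ) : Continuous (logApprox k) := by
  unfold logApprox
  refine Continuous.mul (Continuous.div (by fun_prop) (by fun_prop) fun x => by positivity) ?_
  refine Continuous.div_const (Continuous.log (by fun_prop) fun x => ?_) _
  positivity

theorem tendsto_logApprox (x : ℝ) :
    Tendsto (fun k => logApprox k x) atTop (𝓝 (Real.log x)) := by
  rcases eq_or_ne x 0 with rfl | hx
  · simp [logApprox]
  have hx' : 0 < |x| := abs_pos.2 hx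
  have hk : Tendsto (fun k : ℕ => (k : ℝ) * |x|) atTop atTop :=
    tendsto_natCast_atTop_atTop.atTop_mul_const hx'
  have h1 : Tendsto (fun k : ℕ => (k : ℝ) * |x| / (1 + k * |x|)) atTop (𝓝 1) := by
    have h3 : Tendsto (fun k : ℕ => 1 - (1 + (k : ℝ) * |x|)⁻¹) atTop (𝓝 (1 - 0)) :=
      tendsto_const_nhds.sub (tendsto_inv_atTop_zero.comp (tendsto_atTop_add_const_left _ 1 hk))
    rw [sub_zero] at h3
    refine h3.congr fun k => ?_
    have : 1 + (k : ℝ) * |x| ≠ 0 := by positivity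
    field_simp
    ring
  have h2 : Tendsto (fun k : ℕ => Real.log (x ^ 2 + 1 / ((k : ℝ) + 1)) / 2) atTop
      (𝓝 (Real.log (x ^ 2 + 0) / 2)) := by
    refine Tendsto.div_const (Tendsto.log ?_ (by positivity)) _
    exact tendsto_const_nhds.add tendsto_one_div_add_atTop_nhds_zero_nat
  have := h1.mul h2
  rw [add_zero, Real.log_pow] at this
  have he : 1 * (((2 : ℕ) : ℝ) * Real.log x / 2) = Real.log x := by push_cast; ring
  rw [he] at this
  exact this

/-- The logarithm is a pointwise limit of continuous functions on Hermitian matrices, hence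
measurable, although it is discontinuous where eigenvalues tend to `0`. -/
theorem measurable_opLog_comp {d : ℕ} {α : Type*} [MeasurableSpace α] {f : α → Op d}
    (hf : Measurable f) (hsa : ∀ a, (f a).IsHermitian) : Measurable fun a => opLog (f a) := by
  have hk : ∀ k, Measurable fun a => cfc (logApprox k) (f a) := by
    intro k
    have hc : Continuous fun A : {A : Op d // IsSelfAdjoint A} => cfc (logApprox k) (A : Op d) :=
      Continuous.cfc_of_mem_nhdsSet (s := Set.univ) (logApprox k) univ_mem
        continuous_subtype_val (fun A => A.2) (continuous_logApprox k).continuousOn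
    exact hc.measurable.comp (hf.subtype_mk (h := hsa))
  refine measurable_of_tendsto_metrizable hk (tendsto_pi_nhds.2 fun a => ?_)
  refine tendsto_cfc_fun ?_ (Eventually.of_forall fun k => (continuous_logApprox k).continuousOn)
  have hfin : (spectrum ℝ (f a)).Finite := Matrix.finite_real_spectrum
  rw [Metric.tendstoUniformlyOn_iff]
  intro ε hε
  rw [eventually_all_finite hfin]
  intro x _
  have := (Metric.tendsto_nhds.1 (tendsto_logApprox x)) ε hε
  simpa only [dist_comm] using this

/-! ### The logarithm series in a Banach algebra -/

/-- The factor `‖1‖ + 1` covers `n = 0`, as `‖1‖ = 1` is not assumed. -/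
theorem norm_pow_le_of_norm_le {E : Type*} [NormedRing E] {x : E} {r : ℝ} (hr : ‖x‖ ≤ r) (n : ℕ) :
    ‖x ^ n‖ ≤ (‖(1 : E)‖ + 1) * r ^ n := by
  rcases Nat.eq_zero_or_pos n with rfl | hn
  · simp
  · calc ‖x ^ n‖ ≤ ‖x‖ ^ n := norm_pow_le' x hn
      _ ≤ r ^ n := by gcongr
      _ ≤ (‖(1 : E)‖ + 1) * r ^ n :=
        le_mul_of_one_le_left (pow_nonneg ((norm_nonneg x).trans hr) n)
          (by linarith [norm_nonneg (1 : E)])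

section LogSeries

variable {E : Type*} [NormedRing E] [NormedAlgebra ℝ E]

/-- The series `∑ xⁿ / n`, which is `-log (1 - x)` for `‖x‖ < 1`.  (The term `n = 0` vanishes,
because `0⁻¹ = 0`.) -/
noncomputable def negLogOneSub (x : E) : E := ∑' n : ℕ, (n : ℝ)⁻¹ • x ^ n

variable [CompleteSpace E]

theorem summable_negLogOneSub {x : E} (hx : ‖x‖ < 1) :
    Summable fun n : ℕ => (n : ℝ)⁻¹ • x ^ n := by
  refine Summable.of_norm_bounded
    ((summable_geometric_of_lt_one (norm_nonneg x) hx).mul_left (‖(1 : E)‖ + 1)) fun n => ?_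
  rw [norm_smul, norm_inv, Real.norm_natCast]
  calc (n : ℝ)⁻¹ * ‖x ^ n‖ ≤ 1 * ‖x ^ n‖ := by gcongr; exact Nat.cast_inv_le_one n
    _ ≤ _ := by rw [one_mul]; exact norm_pow_le_of_norm_le le_rfl n

theorem contDiffAt_negLogOneSub {x : E} (hx : ‖x‖ < 1) (n : WithTop ℕ∞) :
    ContDiffAt ℝ n (negLogOneSub : E → E) x := by
  set p := FormalMultilinearSeries.ofScalars E fun n : ℕ => (n : ℝ)⁻¹
  have hrad : (1 : ENNReal) ≤ p.radius := by
    have := p.le_radius_of_bound 1 (r := 1) fun n => ?_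
    · simpa using this
    rcases Nat.eq_zero_or_pos n with rfl | hn
    · have : p 0 = 0 := by simp [p]
      simp [this]
    · rw [NNReal.coe_one, one_pow, mul_one]
      refine (FormalMultilinearSeries.ofScalars_norm_le E (fun n : ℕ => (n : ℝ)⁻¹) n hn).trans ?_
      rw [norm_inv, Real.norm_natCast]
      exact Nat.cast_inv_le_one n
  have h := p.hasFPowerSeriesOnBall (one_pos.trans_le hrad)
  have hsum : p.sum = negLogOneSub := by
    ext y
    simp [FormalMultilinearSeries.sum, p, negLogOneSub, FormalMultilinearSeries.ofScalars_apply_eq]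
  rw [← hsum]
  refine (h.analyticAt_of_mem ?_).contDiffAt
  refine Metric.eball_subset_eball hrad ?_
  rw [Metric.mem_eball, edist_zero_right]
  simpa [enorm_eq_nnnorm, ← NNReal.coe_lt_one] using hx

/-- Under a tracial functional, the series may be differentiated as if its terms commuted, as long
as the other factor commutes with the base point. -/
theorem hasDerivAt_tracial_negLogOneSub (τ : E →L[ℝ] ℝ) (hτ : ∀ a b, τ (a * b) = τ (b * a))
    {x : E} (hx : ‖x‖ < 1) (y : E) :
    HasDerivAt (fun t : ℝ => τ ((1 - x) * negLogOneSub (x + t • y))) (τ y) 0 := by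
  obtain ⟨r, hxr, hr1⟩ := exists_between hx
  have hr0 : 0 < r := (norm_nonneg x).trans_lt hxr
  set K := ‖(1 : E)‖ + 1
  have hK : 0 ≤ K := by positivity
  set S : Set ℝ := (fun t : ℝ => x + t • y) ⁻¹' Metric.ball 0 r with hS
  have hSopen : IsOpen S := Metric.isOpen_ball.preimage (by fun_prop)
  have hSconv : Convex ℝ S := by
    have h1 := ((convex_ball (0 : E) r).translate_preimage_right x).linear_preimage
      (LinearMap.toSpanSingleton ℝ E y)
    exact h1
  have h0 : (0 : ℝ) ∈ S := by simpa [hS] using hxr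
  let g : ℕ → ℝ → ℝ := fun n t => τ ((1 - x) * ((n : ℝ)⁻¹ • (x + t • y) ^ n))
  let g' : ℕ → ℝ → ℝ := fun n t => (n : ℝ)⁻¹ *
    ∑ i ∈ Finset.range n, τ ((1 - x) * ((x + t • y) ^ (n - 1 - i) * y * (x + t • y) ^ i))
  have hg : ∀ n, ∀ t ∈ S, HasDerivAt (g n) (g' n t) t := by
    intro n t _
    have h1 : HasDerivAt (fun t : ℝ => x + t • y) y t := by
      simpa using ((hasDerivAt_id t).smul_const y).const_add x
    have h2 := (h1.hasFDerivAt.pow' n).hasDerivAt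
    have h3 := (((h2.const_smul (n : ℝ)⁻¹).const_mul (1 - x)).hasFDerivAt)
    have h4 := (τ.hasFDerivAt.comp t h3).hasDerivAt
    convert! h4 using 1
    simp [g', Finset.mul_sum, Finset.smul_sum, mul_assoc]
  have hbound : ∀ n, ∀ t ∈ S, ‖g' n t‖ ≤ ‖τ‖ * ‖1 - x‖ * K * K * ‖y‖ * r⁻¹ * r ^ n := by
    intro n t ht
    have hz : ‖x + t • y‖ ≤ r := by
      have : ‖x + t • y‖ < r := by simpa [hS] using ht
      exact this.le
    rcases Nat.eq_zero_or_pos n with rfl | hn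
    · simp only [g', Nat.cast_zero, inv_zero, zero_mul, norm_zero]
      positivity
    have hterm : ∀ i ∈ Finset.range n,
        ‖τ ((1 - x) * ((x + t • y) ^ (n - 1 - i) * y * (x + t • y) ^ i))‖ ≤
          ‖τ‖ * ‖1 - x‖ * K * K * ‖y‖ * r⁻¹ * r ^ n := by
      intro i hi
      have hi' := Finset.mem_range.1 hi
      have hrn : r ^ (n - 1 - i) * r ^ i = r⁻¹ * r ^ n := by
        rw [← pow_add, eq_inv_mul_iff_mul_eq₀ hr0.ne', ← pow_succ']
        congr 1
        omega
      calc ‖τ ((1 - x) * ((x + t • y) ^ (n - 1 - i) * y * (x + t • y) ^ i))‖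
          ≤ ‖τ‖ * (‖1 - x‖ * (‖(x + t • y) ^ (n - 1 - i)‖ * ‖y‖ * ‖(x + t • y) ^ i‖)) := by
            refine (τ.le_opNorm _).trans ?_
            gcongr
            refine (norm_mul_le _ _).trans ?_
            gcongr
            refine (norm_mul_le _ _).trans ?_
            gcongr
            exact norm_mul_le _ _
        _ ≤ ‖τ‖ * (‖1 - x‖ * (K * r ^ (n - 1 - i) * ‖y‖ * (K * r ^ i))) := by
            gcongr
            · exact norm_pow_le_of_norm_le hz _
            · exact norm_pow_le_of_norm_le hz _
        _ = ‖τ‖ * ‖1 - x‖ * K * K * ‖y‖ * (r ^ (n - 1 - i) * r ^ i) := by ring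
        _ = _ := by rw [hrn]; ring
    have hsum := (norm_sum_le _ _).trans (Finset.sum_le_sum hterm)
    rw [Finset.sum_const, Finset.card_range, nsmul_eq_mul] at hsum
    have hn' : (0 : ℝ) < n := Nat.cast_pos.2 hn
    simp only [g', norm_mul, norm_inv, Real.norm_natCast]
    rwa [inv_mul_le_iff₀ hn']
  have hsum0 : Summable fun n => g n 0 := by
    have := ((summable_negLogOneSub hx).mul_left (1 - x)).mapL τ
    simpa [g] using this
  have hd := hasDerivAt_tsum_of_isPreconnected
    ((summable_geometric_of_lt_one hr0.le hr1).mul_left (‖τ‖ * ‖1 - x‖ * K * K * ‖y‖ * r⁻¹))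
    hSopen hSconv.isPreconnected hg hbound h0 hsum0 h0
  -- the derivative at `0` is a geometric series
  have hval : ∑' n, g' n 0 = τ y := by
    have hsucc : ∀ n, g' (n + 1) 0 = τ ((1 - x) * x ^ n * y) := by
      intro n
      have hterm : ∀ i ∈ Finset.range (n + 1),
          τ ((1 - x) * ((x + (0 : ℝ) • y) ^ (n + 1 - 1 - i) * y * (x + (0 : ℝ) • y) ^ i)) =
            τ ((1 - x) * x ^ n * y) := by
        intro i hi
        have hi' := Finset.mem_range.1 hi
        have hc : x ^ i * (1 - x) = (1 - x) * x ^ i :=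
          (((Commute.one_left x).sub_left (Commute.refl x)).pow_right i).eq.symm
        rw [zero_smul, add_zero, ← mul_assoc, hτ, ← mul_assoc, ← mul_assoc, hc,
          mul_assoc (1 - x), ← pow_add]
        congr 4
        omega
      simp only [g']
      rw [Finset.sum_congr rfl hterm, Finset.sum_const, Finset.card_range, nsmul_eq_mul,
        inv_mul_cancel_left₀ (by positivity)]
    have hgeom : HasSum (fun n => τ ((1 - x) * x ^ n * y)) (τ y) := by
      have h1 := (((summable_geometric_of_norm_lt_one hx).hasSum.mul_left (1 - x)).mul_right y).mapL τ
      rwa [mul_neg_geom_series x hx, one_mul] at h1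
    have hs : HasSum (fun n => g' (n + 1) 0) (τ y) := by simpa only [hsucc] using hgeom
    have := (hasSum_nat_add_iff (f := fun n => g' n 0) 1).1 hs
    simpa [g'] using this.tsum_eq
  rw [hval] at hd
  refine hd.congr_of_eventuallyEq ?_
  filter_upwards [hSopen.mem_nhds h0] with t ht
  have hz : ‖x + t • y‖ < 1 := by
    have : ‖x + t • y‖ < r := by simpa [hS] using ht
    exact this.trans hr1
  exact ((((summable_negLogOneSub hz).hasSum.mul_left (1 - x)).mapL τ).tsum_eq).symm

end LogSeries

/-! ### The operator logarithm as a polynomial and as a power series -/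

section OpLog

variable {d : ℕ}

theorem Op.continuousOn_spectrum (f : ℝ → ℝ) (A : Op d) : ContinuousOn f (spectrum ℝ A) :=
  Matrix.finite_real_spectrum.continuousOn f

/-- On any finite family of Hermitian matrices the logarithm is one and the same polynomial, whose
value is moreover prescribed to agree with `Real.log` at `0` and `1`. -/
theorem exists_polynomial_opLog (A B Q : Op d) : ∃ p : Polynomial ℝ,
    p.eval 0 = 0 ∧ p.eval 1 = 0 ∧
    ∀ C ∈ ({A, B, Q} : Set (Op d)), C.IsHermitian → opLog C = Polynomial.aeval C p := by
  have hfin : ({0, 1} ∪ spectrum ℝ A ∪ spectrum ℝ B ∪ spectrum ℝ Q : Set ℝ).Finite :=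
    ((((Set.toFinite _).union Matrix.finite_real_spectrum).union
      Matrix.finite_real_spectrum).union Matrix.finite_real_spectrum)
  set p := Lagrange.interpolate hfin.toFinset id Real.log
  have hp : ∀ x ∈ ({0, 1} ∪ spectrum ℝ A ∪ spectrum ℝ B ∪ spectrum ℝ Q : Set ℝ),
      p.eval x = Real.log x := fun x hx =>
    Lagrange.eval_interpolate_at_node Real.log (Set.injOn_id _) (hfin.mem_toFinset.2 hx)
  refine ⟨p, by rw [hp 0 (by simp), Real.log_zero], by rw [hp 1 (by simp), Real.log_one], ?_⟩
  intro C hC hCh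
  rw [← cfc_polynomial p C (show IsSelfAdjoint C from hCh)]
  refine cfc_congr fun x hx => (hp x ?_).symm
  rcases hC with rfl | rfl | rfl <;> simp [hx]

theorem mul_opLog_eq_zero {B Q : Op d} (hB : B.IsHermitian) (h : Q * B = 0) :
    Q * opLog B = 0 := by
  obtain ⟨p, h0, -, hp⟩ := exists_polynomial_opLog B B B
  rw [hp B (by simp) hB]
  obtain ⟨q, rfl⟩ := Polynomial.X_dvd_iff.2 ((Polynomial.coeff_zero_eq_eval_zero p).trans h0)
  rw [map_mul, Polynomial.aeval_X, ← mul_assoc, h, zero_mul]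

theorem aeval_add_of_isIdempotentElem {R : Type*} [Ring R] [Algebra ℝ R] {B Q : R}
    (hQ : IsIdempotentElem Q) (hBQ : B * Q = 0) (hQB : Q * B = 0) (p : Polynomial ℝ) :
    Polynomial.aeval (B + Q) p = Polynomial.aeval B p + (p.eval 1 - p.eval 0) • Q := by
  induction p using Polynomial.induction_on' with
  | add p q hp hq =>
    simp only [map_add, hp, hq, Polynomial.eval_add]
    module
  | monomial n a =>
    have hpow : ∀ n : ℕ, (B + Q) ^ (n + 1) = B ^ (n + 1) + Q := by
      intro n
      induction n with
      | zero => simp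
      | succ n ih =>
        have h1 : B ^ (n + 1) * Q = 0 := by rw [pow_succ, mul_assoc, hBQ, mul_zero]
        rw [pow_succ, ih, add_mul, mul_add, mul_add, h1, hQB, hQ.eq, add_zero, zero_add,
          ← pow_succ]
    rcases n with _ | n
    · simp
    · simp [Polynomial.aeval_monomial, hpow, mul_add, Algebra.smul_def]

/-- Adding the projection onto a subspace of the kernel does not change the logarithm, because
`log 1 = 0`. -/
theorem opLog_add_of_isIdempotentElem {B Q : Op d} (hB : B.IsHermitian) (hQ : Q.IsHermitian)
    (hQi : IsIdempotentElem Q) (hBQ : B * Q = 0) (hQB : Q * B = 0) :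
    opLog (B + Q) = opLog B := by
  obtain ⟨p, h0, h1, hp⟩ := exists_polynomial_opLog B (B + Q) Q
  rw [hp B (by simp) hB, hp (B + Q) (by simp) (hB.add hQ),
    aeval_add_of_isIdempotentElem hQi hBQ hQB, h0, h1]
  simp

theorem negLogOneSub_eq_cfc {X : Op d} (hX : X.IsHermitian) (h : ‖X‖ < 1) :
    negLogOneSub X = cfc (fun x => -Real.log (1 - x)) X := by
  have hsa : IsSelfAdjoint X := hX
  have hspec : ∀ x ∈ spectrum ℝ X, ‖x‖ < 1 := by
    refine (norm_cfc_lt_iff (id : ℝ → ℝ) X one_pos).1 ?_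
    rwa [cfc_id ℝ X]
  refine tendsto_nhds_unique (summable_negLogOneSub h).hasSum.tendsto_sum_nat ?_
  have hpart : ∀ N : ℕ, cfc (fun x : ℝ => ∑ n ∈ Finset.range N, (n : ℝ)⁻¹ * x ^ n) X =
      ∑ n ∈ Finset.range N, (n : ℝ)⁻¹ • X ^ n := by
    intro N
    have h1 := cfc_polynomial
      (∑ n ∈ Finset.range N, Polynomial.monomial n (n : ℝ)⁻¹) X hsa
    simpa [Polynomial.eval_finsetSum, Polynomial.aeval_monomial, Algebra.smul_def] using h1
  simp only [← hpart]
  refine tendsto_cfc_fun ?_ (Eventually.of_forall fun N => Op.continuousOn_spectrum _ X)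
  have hfin : (spectrum ℝ X).Finite := Matrix.finite_real_spectrum
  rw [Metric.tendstoUniformlyOn_iff]
  intro ε hε
  rw [eventually_all_finite hfin]
  intro x hx
  have hs : HasSum (fun n : ℕ => (n : ℝ)⁻¹ * x ^ n) (-Real.log (1 - x)) := by
    have h1 := Real.hasSum_pow_div_log_of_abs_lt_one (hspec x hx)
    have h2 : HasSum (fun n : ℕ => ((n + 1 : ℕ) : ℝ)⁻¹ * x ^ (n + 1)) (-Real.log (1 - x)) := by
      convert h1 using 2 with n
      push_cast
      ring
    simpa using (hasSum_nat_add_iff (f := fun n : ℕ => (n : ℝ)⁻¹ * x ^ n) 1).1 h2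
  have := (Metric.tendsto_nhds.1 hs.tendsto_sum_nat) ε hε
  simpa only [dist_comm] using this

theorem opLog_eq_negLogOneSub {T : Op d} (hT : T.IsHermitian) {c : ℝ} (hc : 0 < c)
    (h : ‖1 - c⁻¹ • T‖ < 1) :
    opLog T = Real.log c • (1 : Op d) - negLogOneSub (1 - c⁻¹ • T) := by
  have hsa : IsSelfAdjoint T := hT
  have hXeq : 1 - c⁻¹ • T = cfc (fun x : ℝ => 1 - c⁻¹ * x) T := by
    rw [cfc_sub _ _ T, cfc_const_one ℝ T, cfc_const_mul_id c⁻¹ T]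
  have hX : (1 - c⁻¹ • T).IsHermitian := by
    rw [hXeq]; exact cfc_predicate _ T
  have hspec : ∀ x ∈ spectrum ℝ T, ‖1 - c⁻¹ * x‖ < 1 := by
    refine (norm_cfc_lt_iff (fun x : ℝ => 1 - c⁻¹ * x) T one_pos).1 ?_
    rwa [← hXeq]
  rw [negLogOneSub_eq_cfc hX h, hXeq,
    ← cfc_comp (fun x => -Real.log (1 - x)) (fun x : ℝ => 1 - c⁻¹ * x) T hsa
      ((Matrix.finite_real_spectrum.image _).continuousOn _),
    ← Algebra.algebraMap_eq_smul_one, ← cfc_const (Real.log c) T,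
    ← cfc_sub _ _ T (Op.continuousOn_spectrum _ _) (Op.continuousOn_spectrum _ _), opLog]
  refine cfc_congr fun x hx => ?_
  have h1 := abs_lt.1 (hspec x hx)
  have hx0 : 0 < c⁻¹ * x := by linarith
  simp only [Function.comp, sub_sub_cancel, sub_neg_eq_add]
  rw [← Real.log_mul hc.ne' hx0.ne', mul_inv_cancel_left₀ hc.ne']

end OpLog

/-! ### Smoothness of the logarithm on the support -/

section Support

variable {d : ℕ}

/-- If `B ≪ A`, then `B` vanishes on the kernel of `A`, which contains the columns of `C`. -/
theorem mul_eq_zero_of_suppLE {A B C : Op d} (h : SuppLE B A) (hAC : A * C = 0) : B * C = 0 := by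
  rw [suppLE_iff_ker] at h
  have key : ∀ v : Fin d → ℂ, A.mulVec v = 0 → B.mulVec v = 0 := by
    intro v hv
    have h1 : WithLp.toLp 2 v ∈ LinearMap.ker (Matrix.toEuclideanLin A) := by
      simp [LinearMap.mem_ker, hv]
    have h2 := h h1
    simpa [LinearMap.mem_ker] using h2
  refine Matrix.ext_of_mulVec_single fun j => ?_
  rw [← Matrix.mulVec_mulVec, Matrix.zero_mulVec]
  refine key _ ?_
  rw [Matrix.mulVec_mulVec, hAC, Matrix.zero_mulVec]

/-- The orthogonal projection onto the kernel of a Hermitian operator. -/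
noncomputable def kerProj (A : Op d) : Op d := cfc (fun x : ℝ => if x = 0 then 1 else 0) A

theorem kerProj_isHermitian (A : Op d) : (kerProj A).IsHermitian :=
  cfc_predicate (p := IsSelfAdjoint) _ A

theorem kerProj_isIdempotentElem (A : Op d) : IsIdempotentElem (kerProj A) := by
  rw [IsIdempotentElem, kerProj, ← cfc_mul _ _ A (Op.continuousOn_spectrum _ _)
    (Op.continuousOn_spectrum _ _)]
  congr 1
  ext x
  split_ifs <;> simp

theorem mul_kerProj {A : Op d} (hA : A.IsHermitian) : A * kerProj A = 0 := by
  have hsa : IsSelfAdjoint A := hA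
  calc A * kerProj A = cfc (fun x : ℝ => x * if x = 0 then 1 else 0) A := by
        rw [cfc_mul _ _ A (Op.continuousOn_spectrum _ _) (Op.continuousOn_spectrum _ _),
          cfc_id' ℝ A, kerProj]
    _ = cfc (fun _ : ℝ => (0 : ℝ)) A := by
        congr 1
        ext x
        split_ifs with h <;> simp [h]
    _ = 0 := cfc_const_zero ℝ A

theorem mul_kerProj_of_mem {A B : Op d} (hA : A.IsHermitian) (hB : B ∈ hermitianOn A) :
    B * kerProj A = 0 :=
  mul_eq_zero_of_suppLE hB.2 (mul_kerProj hA)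

theorem kerProj_mul_of_mem {A B : Op d} (hA : A.IsHermitian) (hB : B ∈ hermitianOn A) :
    kerProj A * B = 0 := by
  have h := congrArg Matrix.conjTranspose (mul_kerProj_of_mem hA hB)
  rwa [Matrix.conjTranspose_mul, Matrix.conjTranspose_zero, hB.1.eq,
    (kerProj_isHermitian A).eq] at h

/-- `A + kerProj A` is positive definite, so that a suitable multiple of it lies in the disc of
convergence of the logarithm series around the identity. -/
theorem exists_norm_one_sub_lt {A : Op d} (hA : A.PosSemidef) :
    ∃ c : ℝ, 0 < c ∧ ‖1 - c⁻¹ • (A + kerProj A)‖ < 1 := by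
  have hsa : IsSelfAdjoint A := hA.isHermitian
  obtain ⟨M, hM⟩ := (Matrix.finite_real_spectrum (A := A)).bddAbove
  set c := max M 1
  have hc : 0 < c := lt_of_lt_of_le one_pos (le_max_right _ _)
  refine ⟨c, hc, ?_⟩
  -- all eigenvalues of `A + kerProj A` lie in `(0, c]`
  have heq : 1 - c⁻¹ • (A + kerProj A) =
      cfc (fun x : ℝ => 1 - c⁻¹ * (x + if x = 0 then 1 else 0)) A := by
    rw [cfc_sub _ _ A (Op.continuousOn_spectrum _ _) (Op.continuousOn_spectrum _ _),
      cfc_const_one ℝ A, cfc_const_mul _ _ A (Op.continuousOn_spectrum _ _),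
      cfc_add A _ _ (Op.continuousOn_spectrum _ _) (Op.continuousOn_spectrum _ _),
      cfc_id' ℝ A, kerProj]
  rw [heq, norm_cfc_lt_iff _ A one_pos (Op.continuousOn_spectrum _ _)]
  intro x hx
  have hx0 : 0 ≤ x := by
    rw [hA.isHermitian.spectrum_real_eq_range_eigenvalues] at hx
    obtain ⟨i, rfl⟩ := hx
    exact hA.eigenvalues_nonneg i
  have hxc : x ≤ c := (hM hx).trans (le_max_left _ _)
  have hy0 : 0 < x + (if x = 0 then 1 else 0 : ℝ) := by
    split_ifs with h
    · linarith
    · simpa using lt_of_le_of_ne hx0 (Ne.symm h)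
  have hyc : x + (if x = 0 then 1 else 0 : ℝ) ≤ c := by
    split_ifs with h
    · rw [h, zero_add]; exact le_max_right _ _
    · simpa using hxc
  have h1 : 0 < c⁻¹ * (x + (if x = 0 then 1 else 0 : ℝ)) := by positivity
  have h2 : c⁻¹ * (x + (if x = 0 then 1 else 0 : ℝ)) ≤ 1 := by
    rw [inv_mul_le_iff₀ hc]; simpa using hyc
  rw [Real.norm_eq_abs, abs_lt]
  constructor <;> linarith

/-- Near `A`, on the Hermitian operators supported in the support of `A`, the logarithm is given by
its power series around a multiple of the identity. -/
theorem logOn_eventuallyEq {A : Op d} (hA : A.IsHermitian) {c : ℝ} (hc : 0 < c)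
    (h : ‖1 - c⁻¹ • (A + kerProj A)‖ < 1) :
    logOn A =ᶠ[𝓝 (basePt A hA)] fun B =>
      Real.log c • (1 : Op d) - negLogOneSub (1 - c⁻¹ • ((B : Op d) + kerProj A)) := by
  have hcont : Continuous fun B : hermitianOn A => ‖1 - c⁻¹ • ((B : Op d) + kerProj A)‖ := by
    fun_prop
  have h0 : ∀ᶠ B : hermitianOn A in 𝓝 (basePt A hA), ‖1 - c⁻¹ • ((B : Op d) + kerProj A)‖ < 1 :=
    hcont.continuousAt.eventually_lt continuousAt_const h
  filter_upwards [h0] with B hB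
  rw [logOn, ← opLog_add_of_isIdempotentElem B.2.1 (kerProj_isHermitian A)
    (kerProj_isIdempotentElem A) (mul_kerProj_of_mem hA B.2) (kerProj_mul_of_mem hA B.2)]
  exact opLog_eq_negLogOneSub (B.2.1.add (kerProj_isHermitian A)) hc hB

theorem contDiffAt_logOn {A : Op d} (hA : A.PosSemidef) (n : WithTop ℕ∞) :
    ContDiffAt ℝ n (logOn A) (basePt A hA.isHermitian) := by
  obtain ⟨c, hc, h⟩ := exists_norm_one_sub_lt hA
  refine ContDiffAt.congr_of_eventuallyEq ?_ (logOn_eventuallyEq hA.isHermitian hc h)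
  refine contDiffAt_const.sub ?_
  have h1 : ContDiff ℝ n fun B : hermitianOn A => (B : Op d) :=
    (hermitianOn A).subtypeL.contDiff
  have h2 : ContDiff ℝ n fun B : hermitianOn A => 1 - c⁻¹ • ((B : Op d) + kerProj A) :=
    contDiff_const.sub ((h1.add contDiff_const).const_smul c⁻¹)
  have h3 : ContDiffAt ℝ n negLogOneSub (1 - c⁻¹ • (A + kerProj A)) :=
    contDiffAt_negLogOneSub h n
  exact ContDiffAt.fun_comp (f := fun B : hermitianOn A => 1 - c⁻¹ • ((B : Op d) + kerProj A))
    (basePt A hA.isHermitian) h3 h2.contDiffAt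

/-- The real part of the trace, as a continuous real-linear functional. -/
noncomputable def reTrace (d : ℕ) : Op d →L[ℝ] ℝ :=
  LinearMap.toContinuousLinearMap (Complex.reLm ∘ₗ Matrix.traceLinearMap (Fin d) ℝ ℂ)

@[simp]
theorem reTrace_apply (A : Op d) : reTrace d A = A.trace.re := rfl

/-- `Tr[A D[log A](H)] = Tr[H]`: under the trace against `A`, the derivative of `log` at `A`
is multiplication by `A⁻¹` on the support. -/
theorem reTrace_mul_fderiv_logOn {A : Op d} (hA : A.PosSemidef) (H : hermitianOn A) :
    reTrace d (A * fderiv ℝ (logOn A) (basePt A hA.isHermitian) H) = reTrace d H := by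
  set x := basePt A hA.isHermitian
  obtain ⟨c, hc, h⟩ := exists_norm_one_sub_lt hA
  set X := 1 - c⁻¹ • (A + kerProj A)
  have hline : HasDerivAt (fun t : ℝ => x + t • H) H 0 := by
    simpa using ((hasDerivAt_id (0 : ℝ)).smul_const H).const_add x
  have hlog : HasFDerivAt (logOn A) (fderiv ℝ (logOn A) x) (x + (0 : ℝ) • H) := by
    rw [zero_smul, add_zero]
    exact ((contDiffAt_logOn hA 1).differentiableAt one_ne_zero).hasFDerivAt
  have hlog' : HasDerivAt (fun t : ℝ => logOn A (x + t • H)) (fderiv ℝ (logOn A) x H) 0 :=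
    HasFDerivAt.comp_hasDerivAt (l := logOn A) (f := fun t : ℝ => x + t • H) 0 hlog hline
  have h1 : HasDerivAt (fun t : ℝ => reTrace d (A * logOn A (x + t • H)))
      (reTrace d (A * fderiv ℝ (logOn A) x H)) 0 :=
    (reTrace d).hasFDerivAt.comp_hasDerivAt (0 : ℝ) (hlog'.const_mul A)
  have htr := hasDerivAt_tracial_negLogOneSub (reTrace d)
    (fun a b => by rw [reTrace_apply, reTrace_apply, Matrix.trace_mul_comm]) h (-(c⁻¹ • (H : Op d)))
  have h2 := (htr.const_mul c).const_sub (Real.log c * c * reTrace d (1 - X))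
  have h3 : -(c * reTrace d (-(c⁻¹ • (H : Op d)))) = reTrace d H := by
    rw [map_neg, map_smul, smul_eq_mul, mul_neg, neg_neg, mul_inv_cancel_left₀ hc.ne']
  rw [h3] at h2
  refine h1.unique (h2.congr_of_eventuallyEq ?_)
  have hev := (hline.continuousAt.tendsto).eventually
    (show ∀ᶠ B in 𝓝 (x + (0 : ℝ) • H), _ by
      rw [zero_smul, add_zero]; exact logOn_eventuallyEq hA.isHermitian hc h)
  filter_upwards [hev] with t ht
  have hmem := (x + t • H).2
  -- the summand `kerProj A` may be added to `A` because `log` vanishes on the kernel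
  have hker : kerProj A * logOn A (x + t • H) = 0 :=
    mul_opLog_eq_zero hmem.1 (kerProj_mul_of_mem hA.isHermitian hmem)
  have hA1 : A * logOn A (x + t • H) = c • ((1 - X) * logOn A (x + t • H)) := by
    rw [sub_sub_cancel, smul_mul_assoc, smul_smul, mul_inv_cancel₀ hc.ne', one_smul, add_mul,
      hker, add_zero]
  have hX : 1 - c⁻¹ • (((x + t • H : hermitianOn A) : Op d) + kerProj A) =
      X + t • -(c⁻¹ • (H : Op d)) := by
    have : ((x + t • H : hermitianOn A) : Op d) = A + t • (H : Op d) := rfl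
    rw [this]
    simp only [X]
    module
  rw [hA1, ht, hX, map_smul, mul_sub, map_sub, mul_smul_comm, mul_one, map_smul]
  simp only [smul_eq_mul]
  ring

end Support

/-! ### The delta method on a subspace -/

/-- Delta method of order `k`, for variables `Y n` that take values in the range of a linear
embedding `ι` almost surely.  The statistic `Z n` only needs to have an expansion
`q y + (r n) ^ k * R (y / r n)` at the points `Y n = ι y`, with `R` negligible to order `k`. -/
theorem tendstoInDistribution_of_expansion {E₀ E Ω Ω' : Type*} [NormedAddCommGroup E₀]
    [NormedSpace ℝ E₀] [NormedAddCommGroup E] [NormedSpace ℝ E]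
    [FiniteDimensional ℝ E] [MeasurableSpace E] [BorelSpace E]
    [MeasurableSpace Ω] [MeasurableSpace Ω'] {P : Measure Ω} [IsProbabilityMeasure P]
    {P' : Measure Ω'} [IsProbabilityMeasure P'] {Y : ℕ → Ω → E} {Y' : Ω' → E}
    (hY : TendstoInDistribution Y atTop Y' (fun _ => P) P')
    (ι : E₀ →L[ℝ] E) (hι : Function.Injective ι) (hmem : ∀ n, ∀ᵐ ω ∂P, Y n ω ∈ Set.range ι)
    {q R : E₀ → ℝ} (hq : Continuous q) {k : ℕ} (hR : R =o[𝓝 0] fun y => ‖y‖ ^ k)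
    {r : ℕ → ℝ} (hr_pos : ∀ n, 0 < r n) (hr : Tendsto r atTop atTop)
    {Z : ℕ → Ω → ℝ} (hZm : ∀ n, AEMeasurable (Z n) P)
    (hZ : ∀ n, ∀ᵐ ω ∂P, ∀ y, ι y = Y n ω → Z n ω = q y + r n ^ k * R ((r n)⁻¹ • y))
    {T : Ω' → ℝ} (hT : ∀ ω' y, ι y = Y' ω' → q y = T ω') :
    (∀ᵐ ω' ∂P', Y' ω' ∈ Set.range ι) ∧ TendstoInDistribution Z atTop T (fun _ => P) P' := by
  have : CompleteSpace E := FiniteDimensional.complete ℝ E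
  have : ProperSpace E := FiniteDimensional.proper ℝ E
  have hlim : ∀ᵐ ω' ∂P', Y' ω' ∈ Set.range ι :=
    ae_mem_of_tendstoInDistribution hY
      (LinearMap.range (ι : E₀ →ₗ[ℝ] E)).closed_of_finiteDimensional hmem
  refine ⟨hlim, ?_⟩
  obtain ⟨π₀, hπ₀⟩ := (ι : E₀ →ₗ[ℝ] E).exists_leftInverse_of_injective
    (LinearMap.ker_eq_bot.2 hι)
  set π : E →L[ℝ] E₀ := LinearMap.toContinuousLinearMap π₀
  have hπ : ∀ y, π (ι y) = y := fun y => LinearMap.congr_fun hπ₀ y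
  have key := tendstoInDistribution_of_bounded_approx hY (hq.comp π.continuous) hZm ?_
  · refine key.congr (fun _ => EventuallyEq.rfl) ?_
    filter_upwards [hlim] with ω' ⟨y, hy⟩
    rw [Function.comp_apply, Function.comp_apply, ← hy, hπ]
    exact hT ω' y hy
  · intro M η hη
    filter_upwards [eventually_forall_norm_lt_abs_pow_mul_lt hR hr_pos hr (‖π‖ * M + 1) hη]
      with n hn
    filter_upwards [hmem n, hZ n] with ω ⟨y, hy⟩ hω hlt
    rw [hω y hy, Function.comp_apply, ← hy, hπ, add_sub_cancel_left]
    refine hn y ?_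
    calc ‖y‖ = ‖π (ι y)‖ := by rw [hπ]
      _ ≤ ‖π‖ * ‖ι y‖ := π.le_opNorm _
      _ ≤ ‖π‖ * M := by rw [hy]; gcongr
      _ < ‖π‖ * M + 1 := lt_add_one _

/-! ### Second order Taylor expansion -/

/-- The remainder has derivative `f'(x + y) - f'(x) - f''(x) y = o(‖y‖)`, by symmetry of `f''(x)`,
so the mean value inequality gives `o(‖h‖ ^ 2)`. -/
theorem ContDiffAt.isLittleO_taylor_two {E F : Type*} [NormedAddCommGroup E] [NormedSpace ℝ E]
    [NormedAddCommGroup F] [NormedSpace ℝ F] {f : E → F} {x : E} (hf : ContDiffAt ℝ 2 f x) :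
    (fun h => f (x + h) - f x - fderiv ℝ f x h - (1 / 2 : ℝ) • fderiv ℝ (fderiv ℝ f) x h h)
      =o[𝓝 0] fun h => ‖h‖ ^ 2 := by
  set D := fderiv ℝ (fderiv ℝ f) x
  have hsymm : ∀ v w, D v w = D w v := hf.isSymmSndFDerivAt (by simp)
  have hD : HasFDerivAt (fderiv ℝ f) D x :=
    ((hf.fderiv_right (m := 1) (by norm_num)).differentiableAt one_ne_zero).hasFDerivAt
  have hdiff : ∀ᶠ h in 𝓝 (0 : E), DifferentiableAt ℝ f (x + h) := by
    have h1 : ∀ᶠ y in 𝓝 x, DifferentiableAt ℝ f y :=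
      (hf.eventually (by simp)).mono fun y hy => hy.differentiableAt two_ne_zero
    have h2 : Tendsto (fun h : E => x + h) (𝓝 0) (𝓝 x) := by
      simpa using (continuous_const_add x).tendsto (0 : E)
    exact h2.eventually h1
  rw [Asymptotics.isLittleO_iff]
  intro c hc
  obtain ⟨δ, hδ, hb⟩ := Metric.eventually_nhds_iff_ball.1
    (hdiff.and ((hasFDerivAt_iff_isLittleO_nhds_zero.1 hD).def hc))
  filter_upwards [Metric.ball_mem_nhds (0 : E) hδ] with h hh
  have hsub : Metric.closedBall (0 : E) ‖h‖ ⊆ Metric.ball 0 δ :=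
    Metric.closedBall_subset_ball (by simpa using hh)
  have hder : ∀ y ∈ Metric.closedBall (0 : E) ‖h‖, HasFDerivWithinAt
      (fun h => f (x + h) - f x - fderiv ℝ f x h - (1 / 2 : ℝ) • D h h)
      (fderiv ℝ f (x + y) - fderiv ℝ f x - D y) (Metric.closedBall 0 ‖h‖) y := by
    intro y hy
    have h1 : HasFDerivAt (fun h => f (x + h)) (fderiv ℝ f (x + y)) y :=
      (hasFDerivAt_comp_add_left x).2 (hb y (hsub hy)).1.hasFDerivAt
    have h2 : HasFDerivAt (fun h => D h h) ((D y).comp (ContinuousLinearMap.id ℝ E) + D.flip y) y :=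
      D.hasFDerivAt.clm_apply (hasFDerivAt_id y)
    have h3 := ((h1.sub_const (f x)).sub (fderiv ℝ f x).hasFDerivAt).sub (h2.const_smul (1 / 2 : ℝ))
    refine (h3.congr_fderiv ?_).hasFDerivWithinAt
    ext v
    simp only [sub_apply, smul_apply,
      add_apply, ContinuousLinearMap.comp_apply, ContinuousLinearMap.id_apply,
      ContinuousLinearMap.flip_apply, hsymm v y, ← two_smul ℝ (D y v), smul_smul]
    norm_num
  have hbound : ∀ y ∈ Metric.closedBall (0 : E) ‖h‖,
      ‖fderiv ℝ f (x + y) - fderiv ℝ f x - D y‖ ≤ c * ‖h‖ := by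
    intro y hy
    refine (hb y (hsub hy)).2.trans ?_
    gcongr
    simpa using hy
  have := (convex_closedBall (0 : E) ‖h‖).norm_image_sub_le_of_norm_hasFDerivWithin_le hder hbound
    (Metric.mem_closedBall_self (norm_nonneg h)) (show h ∈ Metric.closedBall 0 ‖h‖ by simp)
  simpa [pow_two, mul_assoc] using this

theorem isBigO_sub_bilinear_diagonal {E F : Type*} [NormedAddCommGroup E] [NormedSpace ℝ E]
    [NormedAddCommGroup F] [NormedSpace ℝ F] (D : E →L[ℝ] E →L[ℝ] F) :
    (fun y : E × E => D y.1 y.1 - D y.2 y.2) =O[𝓝 0] fun y => ‖y‖ ^ 2 := by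
  have hquad : ∀ u : E × E →L[ℝ] E, (fun y => D (u y) (u y)) =O[𝓝 0] fun y => ‖y‖ ^ 2 := by
    intro u
    refine Asymptotics.IsBigO.of_bound (‖D‖ * ‖u‖ * ‖u‖) (Eventually.of_forall fun y => ?_)
    rw [norm_pow, norm_norm]
    calc ‖D (u y) (u y)‖ ≤ ‖D‖ * ‖u y‖ * ‖u y‖ := D.le_opNorm₂ _ _
      _ ≤ ‖D‖ * (‖u‖ * ‖y‖) * (‖u‖ * ‖y‖) := by gcongr <;> exact u.le_opNorm y
      _ = _ := by ring
  exact (hquad (ContinuousLinearMap.fst ℝ E E)).sub (hquad (ContinuousLinearMap.snd ℝ E E))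

/-! ### Expansion of the relative entropy -/

section Expansion

variable {d : ℕ}

/-- First order expansion of `(A, B) ↦ Tr[A (log A - log B)]`.  The term `Tr[y.1]` is the
contribution of the derivative of `log` at `A`. -/
theorem isLittleO_relEntropy_one {A B : Op d} (hA : A.PosSemidef) (hB : B.PosSemidef) :
    (fun y : hermitianOn A × hermitianOn B =>
      reTrace d ((A + (y.1 : Op d)) * (opLog (A + (y.1 : Op d)) - opLog (B + (y.2 : Op d)))) -
        reTrace d (A * (opLog A - opLog B)) - reTrace d y.1 -
        reTrace d (y.1 * (opLog A - opLog B) -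
          A * fderiv ℝ (logOn B) (basePt B hB.isHermitian) y.2))
      =o[𝓝 0] fun y => ‖y‖ ^ 1 := by
  set a := basePt A hA.isHermitian
  set b := basePt B hB.isHermitian
  have ha : HasFDerivAt (logOn A) (fderiv ℝ (logOn A) a) (a + (0 : hermitianOn A)) := by
    rw [add_zero]
    exact ((contDiffAt_logOn hA 1).differentiableAt one_ne_zero).hasFDerivAt
  have hb : HasFDerivAt (logOn B) (fderiv ℝ (logOn B) b) (b + (0 : hermitianOn B)) := by
    rw [add_zero]
    exact ((contDiffAt_logOn hB 1).differentiableAt one_ne_zero).hasFDerivAt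
  have h1 : HasFDerivAt (fun y : hermitianOn A × hermitianOn B => logOn A (a + y.1))
      ((fderiv ℝ (logOn A) a).comp (ContinuousLinearMap.fst ℝ _ _)) 0 :=
    HasFDerivAt.comp (f := Prod.fst) (g := fun h => logOn A (a + h))
      (0 : hermitianOn A × hermitianOn B) ((hasFDerivAt_comp_add_left a).2 ha) hasFDerivAt_fst
  have h2 : HasFDerivAt (fun y : hermitianOn A × hermitianOn B => logOn B (b + y.2))
      ((fderiv ℝ (logOn B) b).comp (ContinuousLinearMap.snd ℝ _ _)) 0 :=
    HasFDerivAt.comp (f := Prod.snd) (g := fun h => logOn B (b + h))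
      (0 : hermitianOn A × hermitianOn B) ((hasFDerivAt_comp_add_left b).2 hb) hasFDerivAt_snd
  have h3 : HasFDerivAt (fun y : hermitianOn A × hermitianOn B => A + (y.1 : Op d))
      ((hermitianOn A).subtypeL.comp (ContinuousLinearMap.fst ℝ _ _)) 0 :=
    (((hermitianOn A).subtypeL.hasFDerivAt).comp (0 : hermitianOn A × hermitianOn B)
      hasFDerivAt_fst).const_add A
  have h4 := (reTrace d).hasFDerivAt.comp (0 : hermitianOn A × hermitianOn B)
    (h3.mul' (h1.sub h2))
  have h5 := hasFDerivAt_iff_isLittleO_nhds_zero.1 h4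
  simp only [pow_one]
  refine (h5.congr_left fun y => ?_).norm_right
  have hA0 : logOn A a = opLog A := rfl
  have hB0 : logOn B b = opLog B := rfl
  have hA1 : logOn A (a + y.1) = opLog (A + (y.1 : Op d)) := rfl
  have hB1 : logOn B (b + y.2) = opLog (B + (y.2 : Op d)) := rfl
  have htr : reTrace d (A * fderiv ℝ (logOn A) a y.1) = reTrace d y.1 :=
    reTrace_mul_fderiv_logOn hA y.1
  simp only [Function.comp_apply, zero_add, Prod.fst_zero, Prod.snd_zero, ZeroMemClass.coe_zero,
    add_zero, ContinuousLinearMap.comp_apply, add_apply,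
    smul_apply, sub_apply,
    ContinuousLinearMap.coe_fst', ContinuousLinearMap.coe_snd', Submodule.subtypeL_apply,
    smul_eq_mul, MulOpposite.smul_eq_mul_unop, MulOpposite.unop_op, mul_sub, map_add, map_sub,
    hA0, hB0, hA1, hB1, htr, Pi.sub_apply, Pi.mul_apply]
  ring

/-- Second order expansion of `(A, B) ↦ Tr[A (log A - log B)]` at a point of the diagonal. -/
theorem isLittleO_relEntropy_two {A : Op d} (hA : A.PosSemidef) :
    (fun y : hermitianOn A × hermitianOn A =>
      reTrace d ((A + (y.1 : Op d)) * (opLog (A + (y.1 : Op d)) - opLog (A + (y.2 : Op d)))) - reTrace d (y.1 - y.2) -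
        (reTrace d (y.1 * fderiv ℝ (logOn A) (basePt A hA.isHermitian) (y.1 - y.2)) +
          1 / 2 * reTrace d (A * fderiv ℝ (fderiv ℝ (logOn A)) (basePt A hA.isHermitian)
            (y.1 - y.2) (y.1 + y.2))))
      =o[𝓝 0] fun y => ‖y‖ ^ 2 := by
  set a := basePt A hA.isHermitian
  set G := fderiv ℝ (logOn A) a
  set D := fderiv ℝ (fderiv ℝ (logOn A)) a
  have hcd : ContDiffAt ℝ 2 (logOn A) a := contDiffAt_logOn hA 2
  have hsymm : ∀ v w, D v w = D w v := hcd.isSymmSndFDerivAt (by simp)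
  have htay := hcd.isLittleO_taylor_two
  set T : hermitianOn A → Op d := fun h => logOn A (a + h) - logOn A a - G h - (1 / 2 : ℝ) • D h h
  have hT1 : (fun y : hermitianOn A × hermitianOn A => T y.1) =o[𝓝 0] fun y => ‖y‖ ^ 2 :=
    (htay.comp_tendsto (continuous_fst.tendsto' _ _ rfl)).trans_isBigO
      (Asymptotics.isBigO_fst_prod.norm_norm.pow 2)
  have hT2 : (fun y : hermitianOn A × hermitianOn A => T y.2) =o[𝓝 0] fun y => ‖y‖ ^ 2 :=
    (htay.comp_tendsto (continuous_snd.tendsto' _ _ rfl)).trans_isBigO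
      (Asymptotics.isBigO_snd_prod.norm_norm.pow 2)
  -- the contribution of the Taylor remainders of `log (A + y.1)` and `log (A + y.2)`
  have hlead : (fun y : hermitianOn A × hermitianOn A => (A + (y.1 : Op d)) * (T y.1 - T y.2))
      =o[𝓝 0] fun y => ‖y‖ ^ 2 := by
    have h1 : (fun y : hermitianOn A × hermitianOn A => A + (y.1 : Op d)) =O[𝓝 0]
        fun _ => (1 : ℝ) :=
      (show Continuous fun y : hermitianOn A × hermitianOn A => A + (y.1 : Op d) by
        fun_prop).continuousAt.isBigO_one ℝ
    simpa using h1.mul_isLittleO (hT1.sub hT2)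
  -- the perturbation `y.1` of the prefactor meets the quadratic terms only at third order
  have hcube : (fun y : hermitianOn A × hermitianOn A =>
      (y.1 : Op d) * ((1 / 2 : ℝ) • (D y.1 y.1 - D y.2 y.2))) =o[𝓝 0] fun y => ‖y‖ ^ 2 := by
    have h1 : (fun y : hermitianOn A × hermitianOn A => (y.1 : Op d)) =o[𝓝 0]
        fun _ => (1 : ℝ) :=
      (Asymptotics.isLittleO_one_iff ℝ).2
        ((show Continuous fun y : hermitianOn A × hermitianOn A => (y.1 : Op d) by
          fun_prop).tendsto' _ _ rfl)
    have h2 : (fun y : hermitianOn A × hermitianOn A => (1 / 2 : ℝ) • (D y.1 y.1 - D y.2 y.2))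
        =O[𝓝 0] fun y => ‖y‖ ^ 2 := by
      exact (isBigO_sub_bilinear_diagonal D).const_smul_left (1 / 2 : ℝ)
    simpa using h1.mul_isBigO h2
  refine (((reTrace d).isBigO_comp _ _).trans_isLittleO (hlead.add hcube)).congr_left fun y => ?_
  have hA1 : opLog (A + (y.1 : Op d)) - opLog (A + (y.2 : Op d)) =
      T y.1 - T y.2 + G (y.1 - y.2) + (1 / 2 : ℝ) • (D y.1 y.1 - D y.2 y.2) := by
    have e1 : logOn A (a + y.1) = opLog (A + (y.1 : Op d)) := rfl
    have e2 : logOn A (a + y.2) = opLog (A + (y.2 : Op d)) := rfl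
    simp only [T, e1, e2, map_sub]
    module
  have hpol : D (y.1 - y.2) (y.1 + y.2) = D y.1 y.1 - D y.2 y.2 := by
    simp only [map_sub, map_add, sub_apply, hsymm y.2 y.1]
    abel
  have htr : reTrace d (A * G (y.1 - y.2)) = reTrace d ((y.1 : Op d) - y.2) :=
    reTrace_mul_fderiv_logOn hA (y.1 - y.2)
  rw [hA1, hpol, ← htr]
  simp only [mul_add, add_mul, map_add, mul_smul_comm, map_smul, smul_eq_mul]
  ring

end Expansion

/-! ### The relative entropy of random density operators -/

section RandomRelEntropy

variable {d : ℕ}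

theorem toReal_quantumRelEntropy {A B : Op d} (h : SuppLE A B) :
    (quantumRelEntropy A B).toReal = reTrace d (A * (opLog A - opLog B)) := by
  rw [quantumRelEntropy, if_pos h, EReal.toReal_coe, reTrace_apply]

theorem aemeasurable_toReal_quantumRelEntropy {Ω : Type*} [MeasurableSpace Ω] {P : Measure Ω}
    {ρ σ : Ω → DensityOp d} (hρ : Measurable ρ) (hσ : Measurable σ)
    (h : ∀ᵐ ω ∂P, SuppLE (ρ ω : Op d) (σ ω)) :
    AEMeasurable (fun ω => (quantumRelEntropy (ρ ω : Op d) (σ ω)).toReal) P := by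
  have hρ' := measurable_subtype_coe.comp hρ
  have hσ' := measurable_subtype_coe.comp hσ
  have hlog := (measurable_opLog_comp hρ' fun ω => (ρ ω).isHermitian).sub
    (measurable_opLog_comp hσ' fun ω => (σ ω).isHermitian)
  have hmul : Measurable fun ω => (ρ ω : Op d) * (opLog (ρ ω : Op d) - opLog (σ ω : Op d)) :=
    (continuous_mul (M := Op d)).measurable.comp (hρ'.prodMk hlog)
  refine ⟨_, (reTrace d).continuous.measurable.comp hmul, ?_⟩
  filter_upwards [h] with ω hω
  exact toReal_quantumRelEntropy hω

theorem add_coe_inv_smul {A B C : Op d} {r : ℝ} (hr : r ≠ 0) {h : hermitianOn A}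
    (hh : (h : Op d) = r • (B - C)) : C + ((r⁻¹ • h : hermitianOn A) : Op d) = B := by
  rw [Submodule.coe_smul, hh, smul_smul, inv_mul_cancel₀ hr, one_smul, add_sub_cancel]

theorem reTrace_smul_sub (r : ℝ) (ρ σ : DensityOp d) :
    reTrace d (r • ((ρ : Op d) - σ)) = 0 := by
  rw [map_smul, map_sub, reTrace_apply, reTrace_apply, ρ.2.2, σ.2.2, sub_self, smul_zero]

theorem smul_sub_mem_hermitianOn (r : ℝ) {A B : Op d} (hA : A.IsHermitian) (hB : B.IsHermitian)
    (h : SuppLE B A) : r • (B - A) ∈ hermitianOn A :=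
  (hermitianOn A).smul_mem r ((hermitianOn A).sub_mem ⟨hB, h⟩ (self_mem_hermitianOn hA))

/-- The inclusion of the pairs of Hermitian operators with prescribed supports into all pairs. -/
noncomputable def pairIncl (A B : Op d) : (hermitianOn A × hermitianOn B) →L[ℝ] Op d × Op d :=
  (hermitianOn A).subtypeL.prodMap (hermitianOn B).subtypeL

theorem pairIncl_injective (A B : Op d) : Function.Injective (pairIncl A B) :=
  Subtype.val_injective.prodMap Subtype.val_injective

theorem mem_range_pairIncl {A B : Op d} {p : Op d × Op d} :
    p ∈ Set.range (pairIncl A B) ↔ p.1 ∈ hermitianOn A ∧ p.2 ∈ hermitianOn B := by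
  constructor
  · rintro ⟨y, rfl⟩
    exact ⟨y.1.2, y.2.2⟩
  · rintro ⟨h1, h2⟩
    exact ⟨(⟨p.1, h1⟩, ⟨p.2, h2⟩), rfl⟩

end RandomRelEntropy

theorem theorem1 {d : ℕ}
    {Ω Ω' : Type*} [MeasurableSpace Ω] [MeasurableSpace Ω']
    (P : Measure Ω) [IsProbabilityMeasure P] (P' : Measure Ω') [IsProbabilityMeasure P']
    (ρ σ : DensityOp d) (ρn σn : ℕ → Ω → DensityOp d)
    (hρn : ∀ n, Measurable (ρn n)) (hσn : ∀ n, Measurable (σn n))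
    (r : ℕ → ℝ) (hr_pos : ∀ n, 0 < r n) (hr : Tendsto r atTop atTop)
    (h_supp₁ : ∀ n, ∀ᵐ ω ∂P, SuppLE (ρn n ω : Op d) (σn n ω))
    (h_supp₂ : ∀ n, ∀ᵐ ω ∂P, SuppLE (σn n ω : Op d) σ)
    (h_supp₃ : ∀ n, ∀ᵐ ω ∂P, SuppLE (ρn n ω : Op d) ρ)
    (h_supp₄ : SuppLE (ρ : Op d) σ)
    (L₁ L₂ : Ω' → Op d) :
    -- two-sample alternative
    (TendstoInDistribution
        (fun n ω => (r n • ((ρn n ω : Op d) - ρ), r n • ((σn n ω : Op d) - σ)))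
        atTop (fun ω' => (L₁ ω', L₂ ω')) (fun _ => P) P' →
      LogDiffAt (σ : Op d) σ.isHermitian ∧
      (∀ᵐ ω' ∂P', L₁ ω' ∈ hermitianOn (ρ : Op d) ∧ L₂ ω' ∈ hermitianOn (σ : Op d)) ∧
      TendstoInDistribution
        (fun n ω => r n * ((quantumRelEntropy (ρn n ω : Op d) (σn n ω)).toReal -
          (quantumRelEntropy (ρ : Op d) σ).toReal))
        atTop
        (fun ω' => (L₁ ω' * (opLog (ρ : Op d) - opLog (σ : Op d)) -
          (ρ : Op d) * dLog (σ : Op d) σ.isHermitian (L₂ ω')).trace.re)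
        (fun _ => P) P') ∧
    -- two-sample null
    (ρ = σ →
      TendstoInDistribution
        (fun n ω => (r n • ((ρn n ω : Op d) - ρ), r n • ((σn n ω : Op d) - ρ)))
        atTop (fun ω' => (L₁ ω', L₂ ω')) (fun _ => P) P' →
      LogTwiceDiffAt (ρ : Op d) ρ.isHermitian ∧
      (∀ᵐ ω' ∂P', L₁ ω' ∈ hermitianOn (ρ : Op d) ∧ L₂ ω' ∈ hermitianOn (ρ : Op d)) ∧
      TendstoInDistribution
        (fun n ω => (r n) ^ 2 * (quantumRelEntropy (ρn n ω : Op d) (σn n ω)).toReal)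
        atTop
        (fun ω' =>
          (L₁ ω' * dLog (ρ : Op d) ρ.isHermitian (L₁ ω' - L₂ ω')).trace.re +
          1 / 2 * ((ρ : Op d) *
            d2Log (ρ : Op d) ρ.isHermitian (L₁ ω' - L₂ ω') (L₁ ω' + L₂ ω')).trace.re)
        (fun _ => P) P') := by
  refine ⟨fun hL => ?_, ?_⟩
  · have hd : LogDiffAt (σ : Op d) σ.isHermitian :=
      (contDiffAt_logOn σ.2.1 1).differentiableAt one_ne_zero
    have key := tendstoInDistribution_of_expansion hL (pairIncl (ρ : Op d) (σ : Op d))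
      (pairIncl_injective _ _)
      (q := fun y => reTrace d ((y.1 : Op d) * (opLog (ρ : Op d) - opLog (σ : Op d)) -
        (ρ : Op d) * fderiv ℝ (logOn (σ : Op d)) (basePt (σ : Op d) σ.isHermitian) y.2))
      (hmem := fun n => ?_) (hq := ?_)
      (hR := isLittleO_relEntropy_one ρ.2.1 σ.2.1) hr_pos hr
      (Z := fun n ω => r n * ((quantumRelEntropy (ρn n ω : Op d) (σn n ω)).toReal -
          (quantumRelEntropy (ρ : Op d) σ).toReal))
      (hZm := fun n => ?_) (hZ := fun n => ?_)
      (T := fun ω' => (L₁ ω' * (opLog (ρ : Op d) - opLog (σ : Op d)) -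
          (ρ : Op d) * dLog (σ : Op d) σ.isHermitian (L₂ ω')).trace.re) (hT := ?_)
    · exact ⟨hd, by simpa only [mem_range_pairIncl] using key.1, key.2⟩
    · filter_upwards [h_supp₂ n, h_supp₃ n] with ω h2 h3
      exact mem_range_pairIncl.2 ⟨smul_sub_mem_hermitianOn _ ρ.isHermitian (ρn n ω).isHermitian h3,
        smul_sub_mem_hermitianOn _ σ.isHermitian (σn n ω).isHermitian h2⟩
    · fun_prop
    · exact ((aemeasurable_toReal_quantumRelEntropy (hρn n) (hσn n) (h_supp₁ n)).sub_const
        _).const_mul _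
    · filter_upwards [h_supp₁ n] with ω h1 y hy
      obtain ⟨hy1, hy2⟩ := Prod.ext_iff.1 hy
      have hrn := (hr_pos n).ne'
      have e1 : (ρ : Op d) + (((r n)⁻¹ • y).1 : Op d) = ρn n ω :=
        add_coe_inv_smul hrn hy1
      have e2 : (σ : Op d) + (((r n)⁻¹ • y).2 : Op d) = σn n ω :=
        add_coe_inv_smul hrn hy2
      -- `ρn n ω` and `ρ` both have trace one
      have e3 : reTrace d (((r n)⁻¹ • y).1 : Op d) = 0 := by
        have : (((r n)⁻¹ • y).1 : Op d) = (r n)⁻¹ • (y.1 : Op d) := rfl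
        have h0 : reTrace d (y.1 : Op d) = 0 := by
          rw [show (y.1 : Op d) = _ from hy1]
          exact reTrace_smul_sub _ _ _
        rw [this, map_smul, h0, smul_zero]
      have e4 : r n * reTrace d ((((r n)⁻¹ • y).1 : Op d) * (opLog (ρ : Op d) - opLog (σ : Op d)) -
          (ρ : Op d) * fderiv ℝ (logOn (σ : Op d)) (basePt (σ : Op d) σ.isHermitian)
            ((r n)⁻¹ • y).2) =
          reTrace d ((y.1 : Op d) * (opLog (ρ : Op d) - opLog (σ : Op d)) -
          (ρ : Op d) * fderiv ℝ (logOn (σ : Op d)) (basePt (σ : Op d) σ.isHermitian) y.2) := by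
        rw [Prod.smul_fst, Prod.smul_snd, map_smul, Submodule.coe_smul, smul_mul_assoc,
          mul_smul_comm, ← smul_sub, map_smul, smul_eq_mul, mul_inv_cancel_left₀ hrn]
      rw [e1, e2, e3, toReal_quantumRelEntropy h1, toReal_quantumRelEntropy h_supp₄, ← e4]
      ring
    · rintro ω' y hy
      obtain ⟨hy1, hy2⟩ := Prod.ext_iff.1 hy
      change (y.1 : Op d) = L₁ ω' at hy1
      change (y.2 : Op d) = L₂ ω' at hy2
      have h2 : L₂ ω' ∈ hermitianOn (σ : Op d) := hy2 ▸ y.2.2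
      have h3 : y.2 = ⟨L₂ ω', h2⟩ := Subtype.ext hy2
      simp only [dLog, dif_pos h2, hy1, h3, reTrace_apply]
  · rintro rfl hL
    have hd : LogTwiceDiffAt (ρ : Op d) ρ.isHermitian :=
      ⟨((contDiffAt_logOn ρ.2.1 1).eventually (by simp)).mono fun B hB =>
          hB.differentiableAt one_ne_zero,
        ((contDiffAt_logOn ρ.2.1 2).fderiv_right (m := 1) (by norm_num)).differentiableAt
          one_ne_zero⟩
    have key := tendstoInDistribution_of_expansion hL (pairIncl (ρ : Op d) (ρ : Op d))
      (pairIncl_injective _ _)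
      (q := fun y => reTrace d ((y.1 : Op d) *
          fderiv ℝ (logOn (ρ : Op d)) (basePt (ρ : Op d) ρ.isHermitian) (y.1 - y.2)) +
        1 / 2 * reTrace d ((ρ : Op d) *
          fderiv ℝ (fderiv ℝ (logOn (ρ : Op d))) (basePt (ρ : Op d) ρ.isHermitian)
            (y.1 - y.2) (y.1 + y.2)))
      (hmem := fun n => ?_) (hq := ?_)
      (hR := isLittleO_relEntropy_two ρ.2.1) hr_pos hr
      (Z := fun n ω => (r n) ^ 2 * (quantumRelEntropy (ρn n ω : Op d) (σn n ω)).toReal)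
      (hZm := fun n => ?_) (hZ := fun n => ?_)
      (T := fun ω' => (L₁ ω' * dLog (ρ : Op d) ρ.isHermitian (L₁ ω' - L₂ ω')).trace.re +
          1 / 2 * ((ρ : Op d) *
            d2Log (ρ : Op d) ρ.isHermitian (L₁ ω' - L₂ ω') (L₁ ω' + L₂ ω')).trace.re) (hT := ?_)
    · exact ⟨hd, by simpa only [mem_range_pairIncl] using key.1, key.2⟩
    · filter_upwards [h_supp₂ n, h_supp₃ n] with ω h2 h3
      exact mem_range_pairIncl.2 ⟨smul_sub_mem_hermitianOn _ ρ.isHermitian (ρn n ω).isHermitian h3,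
        smul_sub_mem_hermitianOn _ ρ.isHermitian (σn n ω).isHermitian h2⟩
    · fun_prop
    · exact (aemeasurable_toReal_quantumRelEntropy (hρn n) (hσn n) (h_supp₁ n)).const_mul _
    · filter_upwards [h_supp₁ n] with ω h1 y hy
      obtain ⟨hy1, hy2⟩ := Prod.ext_iff.1 hy
      have hrn := (hr_pos n).ne'
      have e1 : (ρ : Op d) + (((r n)⁻¹ • y).1 : Op d) = ρn n ω :=
        add_coe_inv_smul hrn hy1
      have e2 : (ρ : Op d) + (((r n)⁻¹ • y).2 : Op d) = σn n ω :=
        add_coe_inv_smul hrn hy2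
      -- all three density operators have trace one
      have e3 : reTrace d ((((r n)⁻¹ • y).1 : Op d) - (((r n)⁻¹ • y).2 : Op d)) = 0 := by
        have : (((r n)⁻¹ • y).1 : Op d) - (((r n)⁻¹ • y).2 : Op d) =
          (r n)⁻¹ • ((y.1 : Op d) - (y.2 : Op d)) := (smul_sub _ _ _).symm
        have h0 : reTrace d ((y.1 : Op d) - (y.2 : Op d)) = 0 := by
          rw [show (y.1 : Op d) = _ from hy1, show (y.2 : Op d) = _ from hy2, map_sub,
            reTrace_smul_sub, reTrace_smul_sub, sub_zero]
        rw [this, map_smul, h0, smul_zero]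
      have e4 : ((r n)⁻¹ • y).1 - ((r n)⁻¹ • y).2 = (r n)⁻¹ • (y.1 - y.2) :=
        (smul_sub _ _ _).symm
      have e5 : ((r n)⁻¹ • y).1 + ((r n)⁻¹ • y).2 = (r n)⁻¹ • (y.1 + y.2) :=
        (smul_add _ _ _).symm
      rw [e1, e2, e3, e4, e5, toReal_quantumRelEntropy h1, Prod.smul_fst, Submodule.coe_smul]
      simp only [map_smul, smul_mul_assoc, mul_smul_comm, smul_apply, smul_eq_mul]
      field_simp
      ring
    · rintro ω' y hy
      obtain ⟨hy1, hy2⟩ := Prod.ext_iff.1 hy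
      change (y.1 : Op d) = L₁ ω' at hy1
      change (y.2 : Op d) = L₂ ω' at hy2
      have hs : L₁ ω' - L₂ ω' ∈ hermitianOn (ρ : Op d) := hy1 ▸ hy2 ▸ (y.1 - y.2).2
      have ha : L₁ ω' + L₂ ω' ∈ hermitianOn (ρ : Op d) := hy1 ▸ hy2 ▸ (y.1 + y.2).2
      have hs' : y.1 - y.2 = ⟨L₁ ω' - L₂ ω', hs⟩ := Subtype.ext (by simp [hy1, hy2])
      have ha' : y.1 + y.2 = ⟨L₁ ω' + L₂ ω', ha⟩ := Subtype.ext (by simp [hy1, hy2])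
      simp only [dLog, d2Log, dif_pos hs, dif_pos (And.intro hs ha), hy1, hs', ha', reTrace_apply]
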